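/- **Setting.** Fix a vocabulary $\mathcal X=\{e_1,\dots,e_d\}$ (one-hot vectors in $\mathbb R^d$), $n\ge1$ lags $0<r_1<\dots<r_n$, and integers $M>r_n$, $D\ge 0$. Let $\mathcal P$ be a probability distribution on transition kernels $\pi:\mathcal X^n\to\Delta(\mathcal X)$ and $\mu_0$ a distribution on $\mathcal X^{r_n}$. Given $\pi$, the prompt $x_{1:L}$ ($L>M$) is generated by $(x_1,\dots,x_{r_n})\sim\mu_0$ and $x_l\sim\pi(\cdot\mid x_{l-r_1},\dots,x_{l-r_n})$ for $l>r_n$; let $P_\pi$ be the $d^{r_n}\times d^{r_n}$ transition matrix of the chain of blocks of $r_n$ successive tokens. Assume that there are $\lambda<1$ and $\gamma>0$ such that for every $\pi\in\mathrm{supp}(\mathcal P)$ the matrix $P_\pi$ is primitive, all its eigenvalues other than the leading eigenvalue $1$ have modulus at most $\lambda$, and $\pi(x\mid p)\ge\gamma$ for all $x\in\mathcal X$, $p\in\mathcal X^n$. **Information set.** Let $\mu^\pi$ be the law of a window $(z_{l-M},\dots,z_{l-1},z)$ of $M+1$ tokens of the stationary chain, and for $\mathcal S\subseteq[M]$ write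 $Z_{-\mathcal S}=(z_{l-s})_{s\in\mathcal S}$. Let $\mathcal S^\star$ be a maximizer, over the family $[M]_{\le D}$ of subsets of $[M]$ with at most $D$ elements, of $$\tilde I_{\chi^2}(\mathcal S)=\mathbb E_{\pi\sim\mathcal P,\,(z,Z)\sim\mu^\pi}\Big[\Big(\sum_{e\in\mathcal X}\frac{\mu^\pi(z=e\mid Z_{-\mathcal S})^2}{\mu^\pi(z=e)}-1\Big)\,\mu^\pi(Z_{-\mathcal S})\Big].$$ **GIH estimator.** Let $N$ be the number of $l\in\{M+1,\dots,L\}$ such that $x_{l-s}=x_{L+1-s}$ for all $s\in\mathcal S^\star$. Then $y^\star$ is the average of $x_l$ over these $l$ if $N\ge1$, and the average of $x_{M+1},\dots,x_L$ otherwise. **Transformer.** The parameters are $a\in\mathbb R$, $w^{(h)}=(w^{(h)}_{-1},\dots,w^{(h)}_{-M})\in\mathbb R^M$ for the $H=M$ heads $h\in[M]$, and $c_{\mathcal S}\in\mathbb R$ for $\mathcal S\in[M]_{\le D}$. Put $\sigma^{(h)}=\mathrm{softmax}(w^{(h)})$ and $v^{(h)}_l=\sum_{k=1}^M\sigma^{(h)}_{-k}x_{l-k}$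 for $M<l\le L+1$; let $\phi(v)$ be the vector with entries $c_{\mathcal S}\prod_{h\in\mathcal S}v^{(h)}_{i_h}$, for $\mathcal S\in[M]_{\le D}$ and $(i_h)_{h\in\mathcal S}\in[d]^{\mathcal S}$; put $C_D=\sum_{\mathcal S\in[M]_{\le D}}c_{\mathcal S}^2$, $u_l=\phi(v_l)/\sqrt{C_D}$, $p_{\mathcal S}=c_{\mathcal S}^2/C_D$. The output is $$y=\sum_{l=M+1}^L\frac{\exp(a\langle u_{L+1},u_l\rangle)}{\sum_{k=M+1}^L\exp(a\langle u_{L+1},u_k\rangle)}\,x_l .$$ **Training.** The parameters are trained in three stages, ending at times $t_1\le t_2\le t_3$: only the $c_{\mathcal S}$ move in stage I, only the $w^{(h)}$ in stage II, and only $a$ in stage III (by gradient flow or by any other dynamics within the stages). Let $y$ be the output with the parameters at time $t_3$, write $a=a(t_3)$, and put $$\Delta_1=1-p_{\mathcal S^\star}(t_1),\qquad \Delta_2=1-\prod_{h\in\mathcal S^\star}\big(\sigma^{(h)}_{-h}(t_2)\big)^2 .$$ **Lemma (GIH approximation error).** Suppose that $\Delta_1\le K/L$, $\Delta_2\le K/L$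 and $c_1\log L\le a\le c_2\log L$ with constants $K$, $c_1>0$ and $c_2$. Then for every $\pi\in\mathrm{supp}(\mathcal P)$, with probability at least $1-O(L^{-1})$ over the prompt drawn from $\mu_0$ and $\pi$, $$\|y^\star-y\|_1=O\big(L^{-a/\log L}+L^{-1}\log L\big).$$ If moreover $c_2<1$ (for example $a\le(\log L)/8$), then, with probability at least $1-O(L^{-1})$, $$\|y^\star-y\|_1=O\big(L^{-a/\log L}\big).$$ All implied constants depend only on $d$, $(r_1,\dots,r_n)$, $M$, $D$, $\lambda$, $\gamma$, $K$, $c_1$, $c_2$. -/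

import Mathlib

open MeasureTheory

noncomputable section

namespace NGram

/-! ### n-gram Markov chains -/

/-- A parent structure `(-r_1, …, -r_n)` with `0 < r_1 < ⋯ < r_n` (here with `n + 1` parents, so
that there is at least one). -/
structure Parents (n : ℕ) where
  lag : Fin (n + 1) → ℕ
  pos : ∀ i, 0 < lag i
  strictMono : StrictMono lag

/-- The largest lag `r_n`. -/
def Parents.order {n : ℕ} (pa : Parents n) : ℕ := pa.lag (Fin.last n)

theorem Parents.lag_le_order {n : ℕ} (pa : Parents n) (i : Fin (n + 1)) :
    pa.lag i ≤ pa.order :=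
  pa.strictMono.monotone (Fin.le_last i)

theorem Parents.order_pos {n : ℕ} (pa : Parents n) : 0 < pa.order := pa.pos _

/-- Transition kernels `π : 𝒳ⁿ → Δ(𝒳)` over a vocabulary of size `d`; `π p x` is `π(x ∣ p)`. -/
abbrev TransKernel (d n : ℕ) : Type := (Fin (n + 1) → Fin d) → stdSimplex ℝ (Fin d)

/-- Probability of the string `x_1 … x_T` (stored with indices `0, …, T - 1`) when the first `r_n`
tokens have law `ν` and every later token `x_l` is drawn from `π(· ∣ X_{pa(l)})`.
Meaningful for `r_n ≤ T`. -/
def seqProb {d n : ℕ} (pa : Parents n) (π : TransKernel d n) (ν : (Fin pa.order → Fin d) → ℝ)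
    (T : ℕ) (x : Fin T → Fin d) : ℝ :=
  (if h : pa.order ≤ T then ν (fun i => x (Fin.castLE h i)) else 0) *
    ∏ l : Fin T,
      if pa.order ≤ (l : ℕ) then
        (π fun i => x ⟨(l : ℕ) - pa.lag i, (Nat.sub_le _ _).trans_lt l.isLt⟩).1 (x l)
      else 1

open Classical in
/-- Probability of the event `A` about `x_1 … x_T` for the chain of `seqProb`. -/
def seqPr {d n : ℕ} (pa : Parents n) (π : TransKernel d n) (ν : (Fin pa.order → Fin d) → ℝ)
    (T : ℕ) (A : (Fin T → Fin d) → Prop) : ℝ :=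
  ∑ x : Fin T → Fin d, if A x then seqProb pa π ν T x else 0

open Classical in
/-- The matrix `P_π(Z', Z)` of the chain of `r_n`-token states: column `Z` is the last state
`(z_{l-r_n}, …, z_{l-1})`, row `Z'` the current state `(z_{l-r_n+1}, …, z_l)`. -/
def transMatrix {d n : ℕ} (pa : Parents n) (π : TransKernel d n) :
    Matrix (Fin pa.order → Fin d) (Fin pa.order → Fin d) ℝ :=
  fun Z' Z =>
    if ∀ (i : ℕ) (hi : i + 1 < pa.order), Z' ⟨i, by omega⟩ = Z ⟨i + 1, hi⟩ then
      (π fun i => Z ⟨pa.order - pa.lag i, Nat.sub_lt pa.order_pos (pa.pos i)⟩).1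
        (Z' ⟨pa.order - 1, Nat.sub_lt pa.order_pos Nat.one_pos⟩)
    else 0

/-- `|λ₂(P)| ≤ lam`: after removing one copy of the leading eigenvalue `1`, all complex
eigenvalues (with algebraic multiplicity) have modulus at most `lam`. -/
def SecondEigenvalueLE {ι : Type*} [Fintype ι] [DecidableEq ι] (P : Matrix ι ι ℝ) (lam : ℝ) :
    Prop :=
  open Classical in
  ∀ z ∈ ((P.map (algebraMap ℝ ℂ)).charpoly.roots.erase 1), ‖z‖ ≤ lam

/-- The regularity assumption on the mixture `Pm` (a law on transition kernels) of Markov chains, with spectral bound `lam` and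
lower bound `γ` on the transition probabilities. -/
def MarkovAssumption {d n : ℕ} (pa : Parents n) (Pm : Measure (TransKernel d n)) (lam γ : ℝ) :
    Prop :=
  ∀ π ∈ Pm.support,
    (transMatrix pa π).IsPrimitive ∧ SecondEigenvalueLE (transMatrix pa π) lam ∧
      ∀ p x, γ ≤ (π p).1 x

/-! ### Stationary law, modified `χ²`-mutual information, information set -/

/-- `ν` is a stationary distribution of the chain of `r_n`-token states. -/
def IsStationary {d n : ℕ} (pa : Parents n) (π : TransKernel d n)
    (ν : (Fin pa.order → Fin d) → ℝ) : Prop :=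
  ν ∈ stdSimplex ℝ (Fin pa.order → Fin d) ∧ (transMatrix pa π).mulVec ν = ν

open Classical in
/-- The stationary distribution of the chain with kernel `π` (it exists and is unique when
`transMatrix pa π` is primitive). -/
def stationary {d n : ℕ} (pa : Parents n) (π : TransKernel d n) :
    (Fin pa.order → Fin d) → ℝ :=
  if h : ∃ ν, IsStationary pa π ν then h.choose else 0

/-- The probability under `μ^π`, the stationary law of a window `(z_{l-M}, …, z_l)` of `M + 1`
tokens, of the event `A`. The entry of index `M - s` of a window is `z_{l-s}`. -/
def statPr {d n : ℕ} (pa : Parents n) (M : ℕ) (π : TransKernel d n)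
    (A : (Fin (M + 1) → Fin d) → Prop) : ℝ :=
  seqPr pa π (stationary pa π) (M + 1) A

/-- The token `z_{l-s}` of the window `w = (z_{l-M}, …, z_l)`. -/
def winTok {d M : ℕ} (w : Fin (M + 1) → Fin d) (s : ℕ) : Fin d := w ⟨M - s, by omega⟩

/-- The integrand of the modified `χ²`-mutual information at the kernel `π`. -/
def modChiSqAt {d n : ℕ} (pa : Parents n) (M : ℕ) (S : Finset ℕ) (π : TransKernel d n) : ℝ :=
  ∑ w : Fin (M + 1) → Fin d, seqProb pa π (stationary pa π) (M + 1) w *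
    ((∑ e : Fin d,
        (statPr pa M π (fun w' => winTok w' 0 = e ∧ ∀ s ∈ S, winTok w' s = winTok w s) /
          statPr pa M π (fun w' => ∀ s ∈ S, winTok w' s = winTok w s)) ^ 2 /
        statPr pa M π (fun w' => winTok w' 0 = e)) - 1) *
    statPr pa M π (fun w' => ∀ s ∈ S, winTok w' s = winTok w s)

/-- The modified `χ²`-mutual information `Ĩ_{χ²}(S)`. -/
def modChiSq {d n : ℕ} (pa : Parents n) (M : ℕ) (Pm : Measure (TransKernel d n))
    (S : Finset ℕ) : ℝ :=
  ∫ π, modChiSqAt pa M S π ∂Pm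

/-- `[H]_{≤ D}`: the subsets of `{1, …, H}` with at most `D` elements. -/
def lowDeg (H D : ℕ) : Finset (Finset ℕ) :=
  (Finset.Icc 1 H).powerset.filter fun S => S.card ≤ D

/-- `S` is an information set: a maximizer of `Ĩ_{χ²}` over `[M]_{≤ D}`. -/
def IsInfoSet {d n : ℕ} (pa : Parents n) (M D : ℕ) (Pm : Measure (TransKernel d n))
    (S : Finset ℕ) : Prop :=
  S ∈ lowDeg M D ∧ ∀ T ∈ lowDeg M D, modChiSq pa M Pm T ≤ modChiSq pa M Pm S

/-! ### One-hot embedding and the generalized induction head -/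

/-- The rows of the input `X̃ = (x_1, …, x_L, 0)`, indexed from `1`: row `l ∈ {1, …, L}` is the
one-hot vector of `x_l`, and all other rows are zero. -/
def embed {d L : ℕ} (x : Fin L → Fin d) (l : ℕ) : Fin d → ℝ :=
  if h : 1 ≤ l ∧ l ≤ L then Pi.single (x ⟨l - 1, by omega⟩) 1 else 0

open Classical in
/-- The positions `l ∈ {M+1, …, L}` with `X_{l-S} = X_{L+1-S}`. -/
def matchSet {d L : ℕ} (M : ℕ) (S : Finset ℕ) (x : Fin L → Fin d) : Finset ℕ :=
  (Finset.Icc (M + 1) L).filter fun l => ∀ s ∈ S, embed x (l - s) = embed x (L + 1 - s)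

/-- The output `y*` of the generalized induction head with window `M` and information set `S`. -/
def gih {d L : ℕ} (M : ℕ) (S : Finset ℕ) (x : Fin L → Fin d) : Fin d → ℝ :=
  if 1 ≤ (matchSet M S x).card then
    ((matchSet M S x).card : ℝ)⁻¹ • ∑ l ∈ matchSet M S x, embed x l
  else ((L : ℝ) - M)⁻¹ • ∑ l ∈ Finset.Icc (M + 1) L, embed x l

/-! ### The two-attention-layer transformer `TF(M, H, d, D)` -/

/-- Trainable parameters: `w h k` is `w^{(h)}_{-k}` for `h ∈ {1, …, H}`, `k ∈ {1, …, M}`, and `c S`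
is `c_S` for `S ∈ [H]_{≤ D}` (other values are never used). -/
structure Params where
  a : ℝ
  w : ℕ → ℕ → ℝ
  c : Finset ℕ → ℝ

/-- `exp (W_P(l, j))` for the relative positional embedding `v`, with `exp (-∞) = 0`. -/
def rpeExp (M : ℕ) (v : ℕ → ℝ) (l j : ℕ) : ℝ :=
  if j < l ∧ l - j ≤ M then Real.exp (v (l - j)) else 0

/-- Output `v_l` of one head of the first attention layer, with positional embedding `v`. -/
def headOut {d L : ℕ} (M : ℕ) (v : ℕ → ℝ) (x : Fin L → Fin d) (l : ℕ) : Fin d → ℝ :=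
  ∑ j ∈ Finset.Icc 1 L,
    (rpeExp M v l j / ∑ k ∈ Finset.Icc 1 L, rpeExp M v l k) • embed x j

/-- The coordinates of the FFN features: a set `S ∈ [H]_{≤ D}` and indices `i_h`, `h ∈ S`. -/
abbrev FeatIdx (d H D : ℕ) : Type := (S : lowDeg H D) × (S.1 → Fin d)

/-- The FFN `φ`: its coordinate at `(S, i)` is `c_S ∏_{h ∈ S} v^{(h)}_{i_h}`. -/
def ffn {d : ℕ} (H D : ℕ) (c : Finset ℕ → ℝ) (v : ℕ → Fin d → ℝ) : FeatIdx d H D → ℝ :=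
  fun q => c q.1.1 * ∏ h : q.1.1, v h (q.2 h)

/-- `φ` has the low-degree polynomial kernel. -/
theorem ffn_dotProduct {d : ℕ} (H D : ℕ) (c : Finset ℕ → ℝ) (v v' : ℕ → Fin d → ℝ) :
    ffn H D c v ⬝ᵥ ffn H D c v' =
      ∑ S ∈ lowDeg H D, c S ^ 2 * ∏ h ∈ S, (v h ⬝ᵥ v' h) := by
  rw [← Finset.sum_coe_sort (lowDeg H D)]
  simp only [dotProduct, ffn]
  rw [Fintype.sum_sigma]
  refine Finset.sum_congr rfl fun S _ => ?_
  rw [← Finset.prod_coe_sort S.1, Fintype.prod_sum, Finset.mul_sum]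
  refine Finset.sum_congr rfl fun i _ => ?_
  rw [Finset.prod_mul_distrib]
  ring

/-- `C_D = ∑_{S ∈ [H]_{≤ D}} c_S²`. -/
def normC (H D : ℕ) (c : Finset ℕ → ℝ) : ℝ := ∑ S ∈ lowDeg H D, c S ^ 2

/-- The normalized feature `u_l = φ(v_l) / √C_D`. -/
def feat {d L : ℕ} (M H D : ℕ) (θ : Params) (x : Fin L → Fin d) (l : ℕ) : FeatIdx d H D → ℝ :=
  (Real.sqrt (normC H D θ.c))⁻¹ • ffn H D θ.c (fun h => headOut M (θ.w h) x l)

/-- The output `y` of the transformer `TF(M, H, d, D)` with parameters `θ` on the prompt `x`. -/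
def tf {d L : ℕ} (M H D : ℕ) (θ : Params) (x : Fin L → Fin d) : Fin d → ℝ :=
  ∑ j ∈ Finset.Icc (M + 1) L,
    (Real.exp (θ.a * (feat M H D θ x (L + 1) ⬝ᵥ feat M H D θ x j)) /
      ∑ k ∈ Finset.Icc (M + 1) L,
        Real.exp (θ.a * (feat M H D θ x (L + 1) ⬝ᵥ feat M H D θ x k))) • embed x j

/-! ### Three-stage training -/

/-- The three-stage schedule on `[0, t₁]`, `[t₁, t₂]`, `[t₂, t₃]`: only the `c_S` move in the first
stage, only the `w^{(h)}` in the second, only `a` in the third. The dynamics inside a stage is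
arbitrary, gradient flow on the cross-entropy loss being one instance. -/
structure IsThreeStage (Θ : ℝ → Params) (t₁ t₂ t₃ : ℝ) : Prop where
  t₁_nonneg : 0 ≤ t₁
  t₁_le : t₁ ≤ t₂
  t₂_le : t₂ ≤ t₃
  stage1 : ∀ t ∈ Set.Icc 0 t₁, (Θ t).w = (Θ 0).w ∧ (Θ t).a = (Θ 0).a
  stage2 : ∀ t ∈ Set.Icc t₁ t₂, (Θ t).c = (Θ t₁).c ∧ (Θ t).a = (Θ t₁).a
  stage3 : ∀ t ∈ Set.Icc t₂ t₃, (Θ t).c = (Θ t₂).c ∧ (Θ t).w = (Θ t₂).w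

/-- `p_S = c_S² / C_D`. -/
def pRatio (H D : ℕ) (θ : Params) (S : Finset ℕ) : ℝ := θ.c S ^ 2 / normC H D θ.c

/-- `σ^{(h)}_{-k}`, the softmax of `w^{(h)} ∈ ℝ^M` at the entry `-k`. -/
def attnProb (M : ℕ) (θ : Params) (h k : ℕ) : ℝ :=
  Real.exp (θ.w h k) / ∑ j ∈ Finset.Icc 1 M, Real.exp (θ.w h j)

/-- `Δ₁ = 1 - p_S`. -/
def delta1 (H D : ℕ) (S : Finset ℕ) (θ : Params) : ℝ := 1 - pRatio H D θ S

/-- `Δ₂ = 1 - ∏_{h ∈ S} (σ^{(h)}_{-h})²`. -/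
def delta2 (M : ℕ) (S : Finset ℕ) (θ : Params) : ℝ := 1 - ∏ h ∈ S, attnProb M θ h h ^ 2

/-- The `ℓ¹` norm on `ℝ^d`. -/
def l1norm {d : ℕ} (v : Fin d → ℝ) : ℝ := ∑ k, |v k|

end NGram

end

noncomputable section
namespace NGram

/-! The argument separates a deterministic comparison from one probabilistic input.

Deterministic part. The score of position `l` is `∑ p_T ∏_{h ∈ T} s_h(l)`, where `s_h(l)` is a
convex combination of 0/1 token agreements giving weight `(σ_{-h})²` to agreement at lag `h`. Hence
the score lies in `[1 - Δ₁ - Δ₂, 1]` when `l` matches on `S` and is at most `Δ₁ + Δ₂` otherwise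
(`le_score_of_mem_matchSet`, `score_le_of_notMem_matchSet`). With `ε = K / L` the softmax weights
are nearly constant on the matches and smaller by a factor `exp (4aε - a)` off them. If `N`
positions match, `l1norm_average_sub_weighted_le` bounds the error by a constant times `(L / N) exp
(-a) + aε`, because `aε` stays bounded. The last term is `O(log L / L)`.

Probabilistic part. It remains to see that `N ≥ f L` for a constant `f > 0`. Transition
probabilities are at least `γ`, so whatever the past, a block of `M` tokens equals a prescribed
pattern with probability at least `γ ^ M`. An exponential moment bound over disjoint blocks and a
union bound over all patterns (`le_seqPr_forall_block`) cover the random pattern formed by the last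
`M` tokens. Each earlier copy of it produces a match for every `S ⊆ [M]` at once. -/

/-! ### Expectations along the chain -/

/-- Extend a string to a sequence on `ℕ` by a default token. -/
def extendTok {d T : ℕ} [NeZero d] (x : Fin T → Fin d) (l : ℕ) : Fin d :=
  if h : l < T then x ⟨l, h⟩ else 0

/-- The expectation of `F` under `seqProb`. -/
def seqExp {d n : ℕ} [NeZero d] (pa : Parents n) (π : TransKernel d n)
    (ν : (Fin pa.order → Fin d) → ℝ) (T : ℕ) (F : (ℕ → Fin d) → ℝ) : ℝ :=
  ∑ x : Fin T → Fin d, seqProb pa π ν T x * F (extendTok x)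

/-- `F` depends only on the coordinates below `T`. -/
def DependsBelow {d : ℕ} (T : ℕ) (F : (ℕ → Fin d) → ℝ) : Prop :=
  ∀ z z' : ℕ → Fin d, (∀ i < T, z i = z' i) → F z = F z'

theorem DependsBelow.mono {d T T' : ℕ} {F : (ℕ → Fin d) → ℝ} (h : DependsBelow T F)
    (hT : T ≤ T') : DependsBelow T' F :=
  fun z z' hz => h z z' fun i hi => hz i (hi.trans_le hT)

theorem DependsBelow.mul {d T : ℕ} {F G : (ℕ → Fin d) → ℝ} (hF : DependsBelow T F)
    (hG : DependsBelow T G) : DependsBelow T (fun z => F z * G z) :=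
  fun z z' hz => congrArg₂ _ (hF z z' hz) (hG z z' hz)

section Chain

variable {d n : ℕ} [NeZero d] (pa : Parents n) (π : TransKernel d n)
  (ν : (Fin pa.order → Fin d) → ℝ)

theorem extendTok_snoc_lt {T : ℕ} (x : Fin T → Fin d) (e : Fin d) {i : ℕ} (hi : i < T) :
    extendTok (Fin.snoc (α := fun _ => Fin d) x e) i = extendTok x i := by
  simp [extendTok, hi, hi.trans (Nat.lt_succ_self T), Fin.snoc]

theorem extendTok_snoc_last {T : ℕ} (x : Fin T → Fin d) (e : Fin d) :
    extendTok (Fin.snoc (α := fun _ => Fin d) x e) T = e := by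
  simp [extendTok, Fin.snoc]

omit [NeZero d] in
variable {pa ν} in
theorem seqProb_nonneg (hν : ∀ z, 0 ≤ ν z) (T : ℕ) (x : Fin T → Fin d) :
    0 ≤ seqProb pa π ν T x := by
  unfold seqProb
  refine mul_nonneg ?_ (Finset.prod_nonneg fun l _ => ?_)
  · split_ifs
    · exact hν _
    · exact le_rfl
  · split_ifs
    · exact (π _).2.1 _
    · exact zero_le_one

theorem seqProb_snoc {T : ℕ} (hT : pa.order ≤ T) (x : Fin T → Fin d) (e : Fin d) :
    seqProb pa π ν (T + 1) (Fin.snoc (α := fun _ => Fin d) x e) = seqProb pa π ν T x *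
      (π fun i => extendTok x (T - pa.lag i)).1 e := by
  unfold seqProb
  rw [dif_pos hT, dif_pos (hT.trans T.le_succ), Fin.prod_univ_castSucc, ← mul_assoc]
  congr 1
  · congr 1
    · congr 1
      funext i
      have : (i : ℕ) < T := i.2.trans_le hT
      simp [Fin.snoc, this]
      rfl
    · refine Finset.prod_congr rfl fun l _ => ?_
      have h (i) : (l : ℕ) - pa.lag i < T := (Nat.sub_le _ _).trans_lt l.2
      simp [Fin.snoc, h]
  · have h (i) : T - pa.lag i < T := Nat.sub_lt (pa.order_pos.trans_le hT) (pa.pos i)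
    simp [Fin.snoc, h, hT, extendTok]

omit [NeZero d] in
theorem sum_snoc {T : ℕ} (G : (Fin (T + 1) → Fin d) → ℝ) :
    ∑ y, G y = ∑ x : Fin T → Fin d, ∑ e, G (Fin.snoc (α := fun _ => Fin d) x e) := by
  rw [← (Fin.snocEquiv fun _ : Fin (T + 1) => Fin d).sum_comp, Fintype.sum_prod_type,
    Finset.sum_comm]
  rfl

/-- One step of the chain. -/
theorem seqExp_succ {T : ℕ} (hT : pa.order ≤ T) {F : (ℕ → Fin d) → ℝ} (hF : DependsBelow T F)
    (g : Fin d → ℝ) :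
    seqExp pa π ν (T + 1) (fun z => F z * g (z T)) =
      ∑ x : Fin T → Fin d, seqProb pa π ν T x * F (extendTok x) *
        ∑ e, (π fun i => extendTok x (T - pa.lag i)).1 e * g e := by
  unfold seqExp
  rw [sum_snoc]
  refine Finset.sum_congr rfl fun x _ => ?_
  rw [Finset.mul_sum]
  refine Finset.sum_congr rfl fun e _ => ?_
  simp only []
  rw [seqProb_snoc pa π ν hT, extendTok_snoc_last,
    hF _ (extendTok x) fun i hi => extendTok_snoc_lt x e hi]
  ring

/-- Consistency of the marginals: the last token integrates out because each kernel row sums to one.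
-/
theorem seqExp_succ_of_dependsBelow {T : ℕ} (hT : pa.order ≤ T) {F : (ℕ → Fin d) → ℝ}
    (hF : DependsBelow T F) : seqExp pa π ν (T + 1) F = seqExp pa π ν T F := by
  have := seqExp_succ pa π ν hT hF (fun _ => 1)
  simp only [mul_one, (π _).2.2] at this
  exact this

theorem seqExp_eq_of_dependsBelow {T T' : ℕ} (hT : pa.order ≤ T) (hTT' : T ≤ T')
    {F : (ℕ → Fin d) → ℝ} (hF : DependsBelow T F) :
    seqExp pa π ν T' F = seqExp pa π ν T F := by
  induction T', hTT' using Nat.le_induction with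
  | base => rfl
  | succ k hk ih => rw [seqExp_succ_of_dependsBelow pa π ν (hT.trans hk) (hF.mono hk), ih]

variable {π ν} in
-- Conditionally on the first `T` tokens, the next one equals `q` with probability at least `γ`; `F`
-- plays the role of an arbitrary nonnegative weight on the past.
theorem mul_seqExp_le_seqExp_succ (hν : ∀ z, 0 ≤ ν z) {γ : ℝ} (hπ : ∀ p x, γ ≤ (π p).1 x)
    {T : ℕ} (hT : pa.order ≤ T) {F : (ℕ → Fin d) → ℝ} (hF : DependsBelow T F)
    (hF0 : ∀ z, 0 ≤ F z) (q : Fin d) :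
    γ * seqExp pa π ν T F ≤
      seqExp pa π ν (T + 1) (fun z => F z * if z T = q then 1 else 0) := by
  rw [seqExp_succ pa π ν hT hF (fun e => if e = q then 1 else 0), seqExp, Finset.mul_sum]
  refine Finset.sum_le_sum fun x _ => ?_
  simp only [mul_ite, mul_one, mul_zero, Finset.sum_ite_eq', Finset.mem_univ, if_true]
  rw [mul_comm γ]
  exact mul_le_mul_of_nonneg_left (hπ _ _)
    (mul_nonneg (seqProb_nonneg π hν T x) (hF0 _))

/-! ### Occurrences of a pattern in disjoint blocks -/

/-- The block of length `m` starting at `T` is `q`. -/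
def IsBlock (q : ℕ → Fin d) (T m : ℕ) (z : ℕ → Fin d) : Prop := ∀ j < m, z (T + j) = q j

omit [NeZero d] in
theorem isBlock_congr (q : ℕ → Fin d) {T m : ℕ} {z z' : ℕ → Fin d}
    (h : ∀ i < T + m, z i = z' i) : IsBlock q T m z ↔ IsBlock q T m z' :=
  forall₂_congr fun j hj => by rw [h _ (Nat.add_lt_add_left hj T)]

open Classical in
variable {π ν} in
theorem pow_mul_seqExp_le (hν : ∀ z, 0 ≤ ν z) {γ : ℝ} (hγ : 0 ≤ γ) (hπ : ∀ p x, γ ≤ (π p).1 x)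
    {T : ℕ} (hT : pa.order ≤ T) {F : (ℕ → Fin d) → ℝ} (hF : DependsBelow T F)
    (hF0 : ∀ z, 0 ≤ F z) (q : ℕ → Fin d) (m : ℕ) :
    γ ^ m * seqExp pa π ν T F ≤
      seqExp pa π ν (T + m) (fun z => F z * if IsBlock q T m z then 1 else 0) := by
  induction m with
  | zero => simp [IsBlock]
  | succ m ih =>
    have hdep : DependsBelow (T + m) (fun z => F z * if IsBlock q T m z then 1 else 0) :=
      (hF.mono (Nat.le_add_right T m)).mul fun z z' hz => by simp only [isBlock_congr q hz]
    have hnn : ∀ z, 0 ≤ F z * if IsBlock q T m z then (1 : ℝ) else 0 := fun z =>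
      mul_nonneg (hF0 z) (by split_ifs <;> norm_num)
    calc γ ^ (m + 1) * seqExp pa π ν T F = γ * (γ ^ m * seqExp pa π ν T F) := by ring
      _ ≤ γ * _ := mul_le_mul_of_nonneg_left ih hγ
      _ ≤ _ := mul_seqExp_le_seqExp_succ pa hν hπ (hT.trans (Nat.le_add_right T m)) hdep hnn (q m)
      _ = _ := by
        unfold seqExp
        refine Finset.sum_congr rfl fun x _ => ?_
        have : IsBlock q T (m + 1) (extendTok x) ↔
            IsBlock q T m (extendTok x) ∧ extendTok x (T + m) = q m := by
          simp only [IsBlock, Nat.lt_succ_iff_lt_or_eq, or_imp, forall_and, forall_eq]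
        change seqProb pa π ν (T + m + 1) x * _ = seqProb pa π ν (T + m + 1) x * _
        simp only [this]
        split_ifs <;> simp_all

open Classical in
/-- Each of the first `B` consecutive blocks of length `m` after the initial state that equals `q`
contributes a factor `1 / 2`. -/
def blockWeight (r m B : ℕ) (q z : ℕ → Fin d) : ℝ :=
  ∏ k ∈ Finset.range B, if IsBlock q (r + k * m) m z then (1 / 2 : ℝ) else 1

omit [NeZero d] in
theorem blockWeight_nonneg (r m B : ℕ) (q z : ℕ → Fin d) : 0 ≤ blockWeight r m B q z :=
  Finset.prod_nonneg fun k _ => by split_ifs <;> norm_num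

omit [NeZero d] in
theorem dependsBelow_blockWeight (r m B : ℕ) (q : ℕ → Fin d) :
    DependsBelow (r + B * m) (blockWeight r m B q) := by
  intro z z' hz
  refine Finset.prod_congr rfl fun k hk => ?_
  have hk' : (k + 1) * m ≤ B * m := Nat.mul_le_mul_right m (Finset.mem_range.1 hk)
  rw [add_mul, one_mul] at hk'
  have := isBlock_congr q (T := r + k * m) (m := m) fun i hi => hz i (by omega)
  split_ifs <;> first | rfl | simp_all

theorem seqExp_one (hν : ∑ z, ν z = 1) {T : ℕ} (hT : pa.order ≤ T) :
    seqExp pa π ν T (fun _ => 1) = 1 := by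
  rw [seqExp_eq_of_dependsBelow pa π ν le_rfl hT fun _ _ _ => rfl]
  refine Eq.trans ?_ hν
  refine Finset.sum_congr rfl fun x _ => ?_
  unfold seqProb
  rw [dif_pos le_rfl, Finset.prod_congr rfl (g := fun _ => 1)]
  · rw [Finset.prod_const_one, mul_one, mul_one]
    rfl
  · intro l _
    rw [if_neg (by have := l.2; omega)]

variable {π ν} in
-- Given the past, the next factor is `1 / 2` with probability at least `γ ^ m` and `1` otherwise,
-- so its conditional mean is at most `1 - γ ^ m / 2`. Iterating over the blocks needs no
-- independence.
theorem seqExp_blockWeight_le (hν : ν ∈ stdSimplex ℝ (Fin pa.order → Fin d)) {γ : ℝ}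
    (hγ : 0 ≤ γ) (hγ1 : γ ≤ 1) (hπ : ∀ p x, γ ≤ (π p).1 x) (q : ℕ → Fin d) (m B : ℕ) :
    seqExp pa π ν (pa.order + B * m) (blockWeight pa.order m B q) ≤ (1 - γ ^ m / 2) ^ B := by
  classical
  induction B with
  | zero =>
    have : blockWeight pa.order m 0 q = fun _ => 1 := by funext z; simp [blockWeight]
    rw [this, seqExp_one pa π ν hν.2 (Nat.le_add_right _ _)]
    simp
  | succ B ih =>
    set T := pa.order + B * m
    have hT : pa.order ≤ T := Nat.le_add_right _ _
    have hdep := dependsBelow_blockWeight pa.order m B q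
    have h1 := pow_mul_seqExp_le pa hν.1 hγ hπ hT hdep (blockWeight_nonneg _ _ _ q) q m
    have h2 := seqExp_eq_of_dependsBelow pa π ν hT (Nat.le_add_right T m) hdep
    have hTm : pa.order + (B + 1) * m = T + m := by simp only [T]; ring
    -- The new factor equals one minus half the indicator of the block event.
    have h3 : seqExp pa π ν (T + m) (blockWeight pa.order m (B + 1) q) =
        seqExp pa π ν (T + m) (blockWeight pa.order m B q) - seqExp pa π ν (T + m)
          (fun z => blockWeight pa.order m B q z * if IsBlock q T m z then 1 else 0) / 2 := by
      unfold seqExp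
      rw [Finset.sum_div, ← Finset.sum_sub_distrib]
      refine Finset.sum_congr rfl fun x _ => ?_
      rw [blockWeight, Finset.prod_range_succ, ← blockWeight]
      simp only [T]
      split_ifs <;> ring
    have hp : γ ^ m ≤ 1 := pow_le_one₀ hγ hγ1
    rw [hTm, h3, h2, pow_succ]
    nlinarith

open Classical in
omit [NeZero d] in
-- The pointwise half of a Chernoff bound: few occurrences keep the weight large, since `exp (-1) ≤
-- 1 / 2`.
theorem exp_neg_le_blockWeight {r m B : ℕ} {q z : ℕ → Fin d} {b : ℝ}
    (h : (((Finset.range B).filter fun k => IsBlock q (r + k * m) m z).card : ℝ) ≤ b) :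
    Real.exp (-b) ≤ blockWeight r m B q z := by
  have h2 : Real.exp (-1) ≤ 1 / 2 := by
    rw [Real.exp_neg, one_div]
    exact inv_anti₀ two_pos (by linarith [Real.add_one_le_exp 1])
  calc Real.exp (-b) ≤ Real.exp (-1) ^ ((Finset.range B).filter fun k =>
        IsBlock q (r + k * m) m z).card := by
        rw [← Real.exp_nat_mul]; exact Real.exp_le_exp.2 (by linarith)
    _ ≤ (1 / 2) ^ _ := pow_le_pow_left₀ (Real.exp_pos _).le h2 _
    _ = _ := by
        rw [blockWeight, ← Finset.prod_filter, Finset.prod_const]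

omit [NeZero d] in
theorem seqPr_eq_sum {T : ℕ} (A : (Fin T → Fin d) → Prop) [DecidablePred A] :
    seqPr pa π ν T A = ∑ x, seqProb pa π ν T x * if A x then 1 else 0 := by
  unfold seqPr
  refine Finset.sum_congr rfl fun x _ => ?_
  split_ifs <;> simp

open Classical in
variable {π ν} in
/-- With high probability every pattern occurs among the first `B` blocks with positive
frequency. -/
theorem le_seqPr_forall_block (hν : ν ∈ stdSimplex ℝ (Fin pa.order → Fin d)) {γ : ℝ}
    (hγ : 0 ≤ γ) (hγ1 : γ ≤ 1) (hπ : ∀ p x, γ ≤ (π p).1 x) {m B L : ℕ}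
    (hL : pa.order + B * m ≤ L) :
    1 - (d : ℝ) ^ m * Real.exp (-(γ ^ m * B / 4)) ≤ seqPr pa π ν L fun x =>
      ∀ q : Fin m → Fin d, γ ^ m * B / 4 < (((Finset.range B).filter fun k =>
        IsBlock (extendTok q) (pa.order + k * m) m (extendTok x)).card : ℝ) := by
  set b := γ ^ m * B / 4
  set A : (Fin L → Fin d) → Prop := fun x =>
      ∀ q : Fin m → Fin d, b < (((Finset.range B).filter fun k =>
        IsBlock (extendTok q) (pa.order + k * m) m (extendTok x)).card : ℝ)
  -- The threshold `b` is half of the exponent `γ ^ m * B / 2` obtained here, so Markov's inequality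
  -- leaves `exp b * exp (-(2 * b)) = exp (-b)` per pattern.
  have hexp (q : ℕ → Fin d) :
      seqExp pa π ν L (blockWeight pa.order m B q) ≤ Real.exp (-(2 * b)) := by
    rw [seqExp_eq_of_dependsBelow pa π ν (Nat.le_add_right _ _) hL
      (dependsBelow_blockWeight pa.order m B q)]
    refine (seqExp_blockWeight_le pa hν hγ hγ1 hπ q m B).trans ?_
    have hp : γ ^ m ≤ 1 := pow_le_one₀ hγ hγ1
    calc (1 - γ ^ m / 2) ^ B ≤ Real.exp (-(γ ^ m / 2)) ^ B :=
          pow_le_pow_left₀ (by linarith) (by linarith [Real.add_one_le_exp (-(γ ^ m / 2))]) _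
      _ = _ := by rw [← Real.exp_nat_mul]; congr 1; simp only [b]; ring
  -- Markov's inequality and the union bound in pointwise form: if some pattern is rare, its own
  -- summand is already at least one.
  have hpt (x : Fin L → Fin d) : (1 : ℝ) ≤ (if A x then 1 else 0) +
      ∑ q : Fin m → Fin d, Real.exp b * blockWeight pa.order m B (extendTok q) (extendTok x) := by
    have hnn (q : Fin m → Fin d) :
        0 ≤ Real.exp b * blockWeight pa.order m B (extendTok q) (extendTok x) :=
      mul_nonneg (Real.exp_pos _).le (blockWeight_nonneg _ _ _ _ _)
    split_ifs with h
    · exact le_add_of_nonneg_right (Finset.sum_nonneg fun q _ => hnn q)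
    · simp only [A, not_forall, not_lt] at h
      obtain ⟨q, hq⟩ := h
      rw [zero_add]
      refine le_trans ?_ (Finset.single_le_sum (fun q _ => hnn q) (Finset.mem_univ q))
      calc (1 : ℝ) = Real.exp b * Real.exp (-b) := by rw [← Real.exp_add]; simp
        _ ≤ _ := mul_le_mul_of_nonneg_left (exp_neg_le_blockWeight hq) (Real.exp_pos _).le
  have hsum : (1 : ℝ) ≤ seqPr pa π ν L A + ∑ q : Fin m → Fin d, Real.exp b *
      seqExp pa π ν L (blockWeight pa.order m B (extendTok q)) := by
    rw [← seqExp_one pa π ν hν.2 ((Nat.le_add_right _ _).trans hL), seqPr_eq_sum]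
    simp only [seqExp, Finset.mul_sum]
    rw [Finset.sum_comm, ← Finset.sum_add_distrib]
    refine Finset.sum_le_sum fun x _ => ?_
    have := mul_le_mul_of_nonneg_left (hpt x) (seqProb_nonneg π hν.1 L x)
    rw [mul_add, Finset.mul_sum] at this
    refine this.trans (le_of_eq ?_)
    congr 1
    exact Finset.sum_congr rfl fun q _ => by ring
  have hle : ∑ q : Fin m → Fin d, Real.exp b *
      seqExp pa π ν L (blockWeight pa.order m B (extendTok q)) ≤ (d : ℝ) ^ m * Real.exp (-b) := by
    calc _ ≤ ∑ q : Fin m → Fin d, Real.exp (-b) := Finset.sum_le_sum fun q _ => by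
          calc _ ≤ Real.exp b * Real.exp (-(2 * b)) :=
                mul_le_mul_of_nonneg_left (hexp _) (Real.exp_pos _).le
            _ = Real.exp (-b) := by rw [← Real.exp_add]; congr 1; ring
      _ = _ := by simp
  linarith

omit [NeZero d] in
variable {pa π ν} in
theorem seqPr_mono (hν : ∀ z, 0 ≤ ν z) {T : ℕ} {A A' : (Fin T → Fin d) → Prop}
    (h : ∀ x, A x → A' x) : seqPr pa π ν T A ≤ seqPr pa π ν T A' := by
  refine Finset.sum_le_sum fun x _ => ?_
  have := seqProb_nonneg π hν T x
  split_ifs <;> simp_all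

omit [NeZero d] in
variable {pa π ν} in
theorem seqPr_nonneg (hν : ∀ z, 0 ≤ ν z) {T : ℕ} (A : (Fin T → Fin d) → Prop) :
    0 ≤ seqPr pa π ν T A := by
  refine Finset.sum_nonneg fun x _ => ?_
  have := seqProb_nonneg π hν T x
  split_ifs <;> simp_all

end Chain


/-! ### The attention scores -/

theorem embed_eq_single {d L : ℕ} (x : Fin L → Fin d) {l : ℕ} (h : 1 ≤ l ∧ l ≤ L) :
    embed x l = Pi.single (x ⟨l - 1, by omega⟩) 1 := dif_pos h

theorem embed_nonneg {d L : ℕ} (x : Fin L → Fin d) (l : ℕ) (i : Fin d) : 0 ≤ embed x l i := by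
  unfold embed
  split_ifs
  · by_cases hi : i = x ⟨l - 1, by omega⟩
    · subst hi; simp
    · simp [hi]
  · exact le_rfl

theorem l1norm_embed_le_one {d L : ℕ} (x : Fin L → Fin d) (l : ℕ) : l1norm (embed x l) ≤ 1 := by
  unfold l1norm
  simp only [abs_of_nonneg (embed_nonneg x l _)]
  unfold embed
  split_ifs <;> simp

theorem embed_dotProduct {d L : ℕ} (x : Fin L → Fin d) {l l' : ℕ} (hl : 1 ≤ l ∧ l ≤ L)
    (hl' : 1 ≤ l' ∧ l' ≤ L) [Decidable (embed x l = embed x l')] :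
    embed x l ⬝ᵥ embed x l' = if embed x l = embed x l' then 1 else 0 := by
  split_ifs with h
  · rw [h, embed_eq_single x hl']; simp
  · rw [embed_eq_single x hl, embed_eq_single x hl'] at *
    rw [single_dotProduct, one_mul, Pi.single_eq_of_ne]
    intro h'
    rw [h'] at h
    exact h rfl

theorem sum_ite_window {E : Type*} [AddCommMonoid E] {L M l : ℕ} (hl : M + 1 ≤ l)
    (hl' : l ≤ L + 1) (G : ℕ → E) :
    ∑ j ∈ Finset.Icc 1 L, (if j < l ∧ l - j ≤ M then G j else 0) =
      ∑ k ∈ Finset.Icc 1 M, G (l - k) := by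
  rw [← Finset.sum_filter]
  refine Finset.sum_nbij' (fun j => l - j) (fun k => l - k) ?_ ?_ ?_ ?_ ?_ <;>
    simp only [Finset.mem_filter, Finset.mem_Icc] <;> intro j hj
  · omega
  · omega
  · omega
  · omega
  · rw [Nat.sub_sub_self hj.2.1.le]

/-- For these `l` the whole window `l - M, …, l - 1` lies in `[1, L]`, so the masked softmax
normalizes over all `M` lags. -/
theorem headOut_eq_sum {d L M : ℕ} (θ : Params) (h : ℕ) (x : Fin L → Fin d) {l : ℕ}
    (hl : M + 1 ≤ l) (hl' : l ≤ L + 1) :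
    headOut M (θ.w h) x l = ∑ k ∈ Finset.Icc 1 M, attnProb M θ h k • embed x (l - k) := by
  have hsub : ∀ k ∈ Finset.Icc 1 M, l - (l - k) = k := fun k hk =>
    Nat.sub_sub_self (by have := Finset.mem_Icc.1 hk; omega)
  have hden : ∑ k ∈ Finset.Icc 1 L, rpeExp M (θ.w h) l k =
      ∑ j ∈ Finset.Icc 1 M, Real.exp (θ.w h j) := by
    unfold rpeExp
    rw [sum_ite_window hl hl' fun j => Real.exp (θ.w h (l - j))]
    exact Finset.sum_congr rfl fun k hk => by rw [hsub k hk]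
  unfold headOut
  rw [hden]
  simp only [rpeExp, ite_div, zero_div, ite_smul, zero_smul]
  rw [sum_ite_window hl hl' fun j => (Real.exp (θ.w h (l - j)) /
    ∑ j ∈ Finset.Icc 1 M, Real.exp (θ.w h j)) • embed x j]
  exact Finset.sum_congr rfl fun k hk => by rw [hsub k hk, attnProb]

theorem attnProb_nonneg (M : ℕ) (θ : Params) (h k : ℕ) : 0 ≤ attnProb M θ h k :=
  div_nonneg (Real.exp_pos _).le (Finset.sum_nonneg fun _ _ => (Real.exp_pos _).le)

theorem sum_attnProb {M : ℕ} (hM : 1 ≤ M) (θ : Params) (h : ℕ) :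
    ∑ k ∈ Finset.Icc 1 M, attnProb M θ h k = 1 := by
  unfold attnProb
  rw [← Finset.sum_div]
  exact div_self (Finset.sum_pos (fun _ _ => Real.exp_pos _) (Finset.nonempty_Icc.2 hM)).ne'

theorem attnProb_sq_le_one {M : ℕ} (θ : Params) {h k : ℕ} (hk : k ∈ Finset.Icc 1 M) :
    attnProb M θ h k ^ 2 ≤ 1 := by
  refine pow_le_one₀ (attnProb_nonneg M θ h k) ?_
  rw [← sum_attnProb ((Finset.mem_Icc.1 hk).1.trans (Finset.mem_Icc.1 hk).2) θ h]
  exact Finset.single_le_sum (fun j _ => attnProb_nonneg M θ h j) hk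

/-- Keep one diagonal term of a nonnegative double sum. It is used for the agreement matrix and for
its complement `1 - B`. -/
theorem sq_mul_le_sum_sum {ι : Type*} {I : Finset ι} {σ : ι → ℝ} {B : ι → ι → ℝ}
    (hσ : ∀ i ∈ I, 0 ≤ σ i) (hB : ∀ i ∈ I, ∀ j ∈ I, 0 ≤ B i j) {h : ι} (hh : h ∈ I) :
    σ h ^ 2 * B h h ≤ ∑ i ∈ I, ∑ j ∈ I, σ i * σ j * B i j := by
  have hnn : ∀ i ∈ I, ∀ j ∈ I, 0 ≤ σ i * σ j * B i j := fun i hi j hj =>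
    mul_nonneg (mul_nonneg (hσ i hi) (hσ j hj)) (hB i hi j hj)
  calc σ h ^ 2 * B h h = σ h * σ h * B h h := by ring
    _ ≤ ∑ j ∈ I, σ h * σ j * B h j :=
      Finset.single_le_sum (f := fun j => σ h * σ j * B h j) (hnn h hh) hh
    _ ≤ _ := Finset.single_le_sum (f := fun i => ∑ j ∈ I, σ i * σ j * B i j)
      (fun i hi => Finset.sum_nonneg (hnn i hi)) hh

section Score

variable {d L M : ℕ} (D : ℕ) (θ : Params) (x : Fin L → Fin d)

/-- The similarity of positions `L + 1` and `l` for the head `h`. -/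
def headScore (M : ℕ) (θ : Params) (x : Fin L → Fin d) (h l : ℕ) : ℝ :=
  headOut M (θ.w h) x (L + 1) ⬝ᵥ headOut M (θ.w h) x l

theorem headScore_eq (hML : M < L) (h : ℕ) {l : ℕ} (hl : l ∈ Finset.Icc (M + 1) L) :
    headScore M θ x h l = ∑ i ∈ Finset.Icc 1 M, ∑ j ∈ Finset.Icc 1 M,
      attnProb M θ h i * attnProb M θ h j * (embed x (L + 1 - i) ⬝ᵥ embed x (l - j)) := by
  rw [Finset.mem_Icc] at hl
  rw [headScore, headOut_eq_sum θ h x (by omega) le_rfl, headOut_eq_sum θ h x hl.1 (by omega),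
    sum_dotProduct]
  refine Finset.sum_congr rfl fun i _ => ?_
  rw [dotProduct_sum]
  refine Finset.sum_congr rfl fun j _ => ?_
  rw [smul_dotProduct, dotProduct_smul, smul_eq_mul, smul_eq_mul, mul_assoc]

/-- The score averages 0/1 agreements `B i j` with weights `σ_i σ_j` of total mass one. The diagonal
term at `h` bounds the score from below under agreement, and bounds one minus the score from below
under disagreement. -/
theorem headScore_bounds (hML : M < L) {h : ℕ} (hh : h ∈ Finset.Icc 1 M) {l : ℕ}
    (hl : l ∈ Finset.Icc (M + 1) L) :
    0 ≤ headScore M θ x h l ∧ headScore M θ x h l ≤ 1 ∧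
    (embed x (l - h) = embed x (L + 1 - h) → attnProb M θ h h ^ 2 ≤ headScore M θ x h l) ∧
    (embed x (l - h) ≠ embed x (L + 1 - h) → headScore M θ x h l ≤ 1 - attnProb M θ h h ^ 2) := by
  classical
  set B : ℕ → ℕ → ℝ := fun i j => embed x (L + 1 - i) ⬝ᵥ embed x (l - j)
  have hBeq : ∀ i ∈ Finset.Icc 1 M, ∀ j ∈ Finset.Icc 1 M,
      B i j = if embed x (L + 1 - i) = embed x (l - j) then 1 else 0 := by
    intro i hi j hj
    rw [Finset.mem_Icc] at hi hj hl
    exact embed_dotProduct x (by omega) (by omega)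
  have hB0 : ∀ i ∈ Finset.Icc 1 M, ∀ j ∈ Finset.Icc 1 M, 0 ≤ B i j := fun i hi j hj => by
    rw [hBeq i hi j hj]; split_ifs <;> norm_num
  have hB1 : ∀ i ∈ Finset.Icc 1 M, ∀ j ∈ Finset.Icc 1 M, 0 ≤ 1 - B i j := fun i hi j hj => by
    rw [hBeq i hi j hj]; split_ifs <;> norm_num
  have hσ : ∀ i ∈ Finset.Icc 1 M, 0 ≤ attnProb M θ h i := fun i _ => attnProb_nonneg M θ h i
  have hM : 1 ≤ M := (Finset.mem_Icc.1 hh).1.trans (Finset.mem_Icc.1 hh).2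
  have e := headScore_eq θ x hML h hl
  have h1 := sq_mul_le_sum_sum hσ hB0 hh
  have h2 := sq_mul_le_sum_sum hσ hB1 hh
  have h3 : ∑ i ∈ Finset.Icc 1 M, ∑ j ∈ Finset.Icc 1 M,
      attnProb M θ h i * attnProb M θ h j * (1 - B i j) = 1 - headScore M θ x h l := by
    simp only [mul_sub, mul_one, Finset.sum_sub_distrib, e]
    rw [← Finset.sum_mul_sum, sum_attnProb hM, mul_one]
  rw [h3] at h2
  rw [← e] at h1
  have h4 := mul_nonneg (sq_nonneg (attnProb M θ h h)) (hB0 h hh h hh)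
  have h5 := mul_nonneg (sq_nonneg (attnProb M θ h h)) (hB1 h hh h hh)
  refine ⟨h4.trans h1, by linarith, fun hm => ?_, fun hm => ?_⟩
  · rwa [hBeq h hh h hh, if_pos hm.symm, mul_one] at h1
  · rw [hBeq h hh h hh, if_neg (Ne.symm hm), sub_zero, mul_one] at h2
    linarith

theorem feat_dotProduct (l : ℕ) :
    feat M M D θ x (L + 1) ⬝ᵥ feat M M D θ x l =
      ∑ S ∈ lowDeg M D, pRatio M D θ S * ∏ h ∈ S, headScore M θ x h l := by
  have hC : 0 ≤ normC M D θ.c := Finset.sum_nonneg fun _ _ => sq_nonneg _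
  unfold feat
  rw [smul_dotProduct, dotProduct_smul, ffn_dotProduct, smul_eq_mul, smul_eq_mul, ← mul_assoc,
    ← mul_inv, Real.mul_self_sqrt hC, Finset.mul_sum]
  refine Finset.sum_congr rfl fun S _ => ?_
  rw [pRatio, div_eq_mul_inv]
  simp only [headScore]
  ring

theorem pRatio_nonneg (S : Finset ℕ) : 0 ≤ pRatio M D θ S :=
  div_nonneg (sq_nonneg _) (Finset.sum_nonneg fun _ _ => sq_nonneg _)

/-- Only an inequality: when every `c_S` vanishes, the ratios are `0 / 0 = 0`. -/
theorem sum_pRatio_le_one : ∑ S ∈ lowDeg M D, pRatio M D θ S ≤ 1 := by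
  unfold pRatio
  rw [← Finset.sum_div]
  exact div_self_le_one _

variable {D} {S : Finset ℕ}

theorem subset_of_mem_lowDeg (hS : S ∈ lowDeg M D) : S ⊆ Finset.Icc 1 M :=
  Finset.mem_powerset.1 (Finset.mem_filter.1 hS).1

theorem delta1_nonneg (hS : S ∈ lowDeg M D) : 0 ≤ delta1 M D S θ :=
  sub_nonneg.2 ((Finset.single_le_sum (fun S _ => pRatio_nonneg D θ S) hS).trans
    (sum_pRatio_le_one D θ))

theorem delta2_nonneg (hS : S ∈ lowDeg M D) : 0 ≤ delta2 M S θ :=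
  sub_nonneg.2 (Finset.prod_le_one (fun _ _ => sq_nonneg _) fun _ hh =>
    attnProb_sq_le_one θ (subset_of_mem_lowDeg hS hh))

theorem prod_headScore_nonneg (hML : M < L) (hS : S ∈ lowDeg M D) {l : ℕ}
    (hl : l ∈ Finset.Icc (M + 1) L) : 0 ≤ ∏ h ∈ S, headScore M θ x h l :=
  Finset.prod_nonneg fun _ hh => (headScore_bounds θ x hML (subset_of_mem_lowDeg hS hh) hl).1

theorem prod_headScore_le_one (hML : M < L) (hS : S ∈ lowDeg M D) {l : ℕ}
    (hl : l ∈ Finset.Icc (M + 1) L) : ∏ h ∈ S, headScore M θ x h l ≤ 1 :=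
  Finset.prod_le_one
    (fun _ hh => (headScore_bounds θ x hML (subset_of_mem_lowDeg hS hh) hl).1)
    fun _ hh => (headScore_bounds θ x hML (subset_of_mem_lowDeg hS hh) hl).2.1

theorem score_le_one (hML : M < L) {l : ℕ} (hl : l ∈ Finset.Icc (M + 1) L) :
    feat M M D θ x (L + 1) ⬝ᵥ feat M M D θ x l ≤ 1 := by
  rw [feat_dotProduct]
  exact (Finset.sum_le_sum fun S hS => mul_le_of_le_one_right (pRatio_nonneg D θ S)
    (prod_headScore_le_one θ x hML hS hl)).trans (sum_pRatio_le_one D θ)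

theorem le_score_of_mem_matchSet (hML : M < L) (hS : S ∈ lowDeg M D) {l : ℕ}
    (hl : l ∈ matchSet M S x) :
    1 - delta1 M D S θ - delta2 M S θ ≤ feat M M D θ x (L + 1) ⬝ᵥ feat M M D θ x l := by
  obtain ⟨hl, hm⟩ := Finset.mem_filter.1 hl
  have h1 : ∏ h ∈ S, attnProb M θ h h ^ 2 ≤ ∏ h ∈ S, headScore M θ x h l :=
    Finset.prod_le_prod (fun _ _ => sq_nonneg _) fun h hh =>
      (headScore_bounds θ x hML (subset_of_mem_lowDeg hS hh) hl).2.2.1 (hm h hh)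
  have h2 := mul_nonneg (delta1_nonneg θ hS) (delta2_nonneg θ hS)
  rw [feat_dotProduct]
  calc _ ≤ (1 - delta1 M D S θ) * (1 - delta2 M S θ) := by linarith
    _ = pRatio M D θ S * ∏ h ∈ S, attnProb M θ h h ^ 2 := by simp [delta1, delta2]
    _ ≤ pRatio M D θ S * ∏ h ∈ S, headScore M θ x h l :=
      mul_le_mul_of_nonneg_left h1 (pRatio_nonneg D θ S)
    _ ≤ _ := Finset.single_le_sum (f := fun S => pRatio M D θ S * ∏ h ∈ S, headScore M θ x h l)
      (fun T hT => mul_nonneg (pRatio_nonneg D θ T) (prod_headScore_nonneg θ x hML hT hl)) hS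

/-- A mismatched lag `h ∈ S` makes the product for `S` at most `1 - σ_h² ≤ Δ₂`; the remaining sets
have total weight at most `1 - p_S = Δ₁`. -/
theorem score_le_of_notMem_matchSet (hML : M < L) (hS : S ∈ lowDeg M D) {l : ℕ}
    (hl : l ∈ Finset.Icc (M + 1) L) (hlm : l ∉ matchSet M S x) :
    feat M M D θ x (L + 1) ⬝ᵥ feat M M D θ x l ≤ delta1 M D S θ + delta2 M S θ := by
  have hex : ∃ h ∈ S, embed x (l - h) ≠ embed x (L + 1 - h) := by
    by_contra! hcon
    exact hlm (Finset.mem_filter.2 ⟨hl, hcon⟩)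
  obtain ⟨h, hh, hne⟩ := hex
  have hsub := subset_of_mem_lowDeg hS
  have hp : ∏ h ∈ S, headScore M θ x h l ≤ delta2 M S θ := by
    have h1 : ∏ h ∈ S, headScore M θ x h l ≤ headScore M θ x h l := by
      rw [← Finset.mul_prod_erase S _ hh]
      exact mul_le_of_le_one_right (headScore_bounds θ x hML (hsub hh) hl).1
        (Finset.prod_le_one
          (fun _ hk => (headScore_bounds θ x hML (hsub (Finset.mem_of_mem_erase hk)) hl).1)
          fun _ hk => (headScore_bounds θ x hML (hsub (Finset.mem_of_mem_erase hk)) hl).2.1)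
    have h2 : ∏ h ∈ S, attnProb M θ h h ^ 2 ≤ attnProb M θ h h ^ 2 := by
      rw [← Finset.mul_prod_erase S _ hh]
      exact mul_le_of_le_one_right (sq_nonneg _) (Finset.prod_le_one (fun _ _ => sq_nonneg _)
        fun _ hk => attnProb_sq_le_one θ (hsub (Finset.mem_of_mem_erase hk)))
    have h3 := (headScore_bounds θ x hML (hsub hh) hl).2.2.2 hne
    rw [delta2]
    linarith
  rw [feat_dotProduct, ← Finset.add_sum_erase _ _ hS]
  have h4 : ∑ T ∈ (lowDeg M D).erase S, pRatio M D θ T * ∏ h ∈ T, headScore M θ x h l ≤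
      ∑ T ∈ (lowDeg M D).erase S, pRatio M D θ T :=
    Finset.sum_le_sum fun T hT => mul_le_of_le_one_right (pRatio_nonneg D θ T)
      (prod_headScore_le_one θ x hML (Finset.mem_of_mem_erase hT) hl)
  have h5 := sum_pRatio_le_one (M := M) D θ
  rw [← Finset.add_sum_erase _ _ hS] at h5
  have h6 := mul_le_mul_of_nonneg_left hp (pRatio_nonneg (M := M) D θ S)
  have h7 : pRatio M D θ S * delta2 M S θ ≤ delta2 M S θ :=
    mul_le_of_le_one_left (delta2_nonneg θ hS) (by have := delta1_nonneg θ hS; rw [delta1] at this; linarith)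
  rw [delta1]
  linarith

end Score

/-! ### Averages and weighted averages -/

theorem l1norm_sum_smul_le {d : ℕ} {ι : Type*} (I : Finset ι) (r : ι → ℝ) (e : ι → Fin d → ℝ)
    (he : ∀ i ∈ I, l1norm (e i) ≤ 1) : l1norm (∑ i ∈ I, r i • e i) ≤ ∑ i ∈ I, |r i| := by
  calc l1norm (∑ i ∈ I, r i • e i) ≤ ∑ k, ∑ i ∈ I, |r i| * |e i k| := by
        refine Finset.sum_le_sum fun k _ => ?_
        rw [Finset.sum_apply]
        refine (Finset.abs_sum_le_sum_abs _ _).trans (le_of_eq ?_)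
        exact Finset.sum_congr rfl fun i _ => by rw [Pi.smul_apply, smul_eq_mul, abs_mul]
    _ = ∑ i ∈ I, |r i| * l1norm (e i) := by
        rw [Finset.sum_comm]
        simp only [l1norm, Finset.mul_sum]
    _ ≤ _ := Finset.sum_le_sum fun i hi => mul_le_of_le_one_right (abs_nonneg _) (he i hi)

/-- The average over `A` is close to a weighted average over `I ⊇ A` whose weights are nearly
constant on `A` and small outside `A`. -/
theorem l1norm_average_sub_weighted_le {d : ℕ} {ι : Type*} [DecidableEq ι] {I A : Finset ι}
    (hA : A ⊆ I) (hN : 0 < A.card) (w : ι → ℝ) (e : ι → Fin d → ℝ)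
    (he : ∀ i ∈ I, l1norm (e i) ≤ 1) (hw : ∀ i ∈ I, 0 ≤ w i) {α β κ : ℝ} (hα : 0 < α)
    (hwα : ∀ i ∈ A, α ≤ w i) (hwβ : ∀ i ∈ A, w i ≤ β) (hκ : 0 ≤ κ)
    (hwκ : ∀ i ∈ I, i ∉ A → w i ≤ κ) :
    l1norm ((A.card : ℝ)⁻¹ • ∑ i ∈ A, e i - ∑ i ∈ I, (w i / ∑ k ∈ I, w k) • e i) ≤
      2 * (I.card * κ / (A.card * α)) + (β / α - 1) := by
  set N := (A.card : ℝ)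
  have hN' : 0 < N := Nat.cast_pos.2 hN
  set W := ∑ k ∈ I, w k
  have hWA : N * α ≤ ∑ i ∈ A, w i := by
    rw [← nsmul_eq_mul]; exact Finset.card_nsmul_le_sum A w α hwα
  have hWA' : ∑ i ∈ A, w i ≤ N * β := by
    rw [← nsmul_eq_mul]; exact Finset.sum_le_card_nsmul A w β hwβ
  have hsplit : ∑ i ∈ I \ A, w i + ∑ i ∈ A, w i = W := Finset.sum_sdiff hA
  have hout : ∑ i ∈ I \ A, w i ≤ I.card * κ := by
    calc ∑ i ∈ I \ A, w i ≤ (I \ A).card • κ := Finset.sum_le_card_nsmul _ _ _ fun i hi =>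
          hwκ i (Finset.mem_sdiff.1 hi).1 (Finset.mem_sdiff.1 hi).2
      _ ≤ _ := by
          rw [nsmul_eq_mul]
          gcongr
          exact Finset.sdiff_subset
  have hout0 : 0 ≤ ∑ i ∈ I \ A, w i := Finset.sum_nonneg fun i hi => hw i (Finset.mem_sdiff.1 hi).1
  have hNα : 0 < N * α := mul_pos hN' hα
  have hW : N * α ≤ W := by linarith
  have hW0 : 0 < W := hNα.trans_le hW
  have hαβ : α ≤ β := by
    obtain ⟨i, hi⟩ := Finset.card_pos.1 hN
    exact (hwα i hi).trans (hwβ i hi)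
  -- `q` bounds the weight outside `A` relative to that on `A`. It enters twice: through the mass
  -- outside, and through the mass thereby lost on `A`.
  set q := I.card * κ / (N * α)
  have hq : I.card * κ = q * (N * α) := by simp only [q]; field_simp
  have hIκ : 0 ≤ I.card * κ := mul_nonneg (Nat.cast_nonneg _) hκ
  have hq0 : 0 ≤ q := div_nonneg hIκ hNα.le
  have hpt : ∀ i ∈ A, |N⁻¹ - w i / W| ≤ (q + (β / α - 1)) / N := by
    intro i hi
    have hub : w i / W ≤ β / (N * α) :=
      div_le_div₀ (hα.le.trans hαβ) (hwβ i hi) hNα hW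
    have hub' : β / (N * α) = (β / α) / N := by field_simp
    have hlb : N⁻¹ - (q + (β / α - 1)) / N ≤ w i / W := by
      rw [le_div_iff₀ hW0]
      have hWle : W ≤ N * β + q * (N * α) := by linarith
      have hr : 1 ≤ β / α := (one_le_div hα).2 hαβ
      have hβ : β = β / α * α := by field_simp
      set r := β / α
      have hWle' : W ≤ (r + q) * (N * α) := by rw [hβ] at hWle; linarith
      have e1 : N⁻¹ - (q + (r - 1)) / N = (2 - (r + q)) / N := by field_simp; ring
      rw [e1]
      refine le_trans ?_ (hwα i hi)
      rw [div_mul_eq_mul_div, div_le_iff₀ hN']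
      rcases le_total (2 - (r + q)) 0 with h | h
      · nlinarith [mul_nonneg (neg_nonneg.2 h) hW0.le]
      · have := mul_le_mul_of_nonneg_left hWle' h
        -- This is `(2 - t) * t ≤ 1` at `t = r + q`.
        nlinarith [mul_nonneg (sq_nonneg (r + q - 1)) hNα.le]
    rw [abs_le]
    constructor
    · have : (q + (β / α - 1)) / N = q / N + (β / α) / N - N⁻¹ := by
        rw [← one_div]; ring
      have hqN : 0 ≤ q / N := div_nonneg hq0 hN'.le
      linarith
    · linarith
  have hrew : N⁻¹ • ∑ i ∈ A, e i - ∑ i ∈ I, (w i / W) • e i =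
      ∑ i ∈ I, ((if i ∈ A then N⁻¹ else 0) - w i / W) • e i := by
    simp only [sub_smul, Finset.sum_sub_distrib, ite_smul, zero_smul]
    rw [← Finset.sum_filter, Finset.filter_mem_eq_inter, Finset.inter_eq_right.2 hA,
      Finset.smul_sum]
  rw [hrew]
  refine (l1norm_sum_smul_le _ _ _ he).trans ?_
  rw [← Finset.sum_sdiff hA]
  have hS1 : ∑ i ∈ I \ A, |(if i ∈ A then N⁻¹ else 0) - w i / W| ≤ q := by
    calc _ = (∑ i ∈ I \ A, w i) / W := by
          rw [Finset.sum_div]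
          refine Finset.sum_congr rfl fun i hi => ?_
          obtain ⟨hi, hiA⟩ := Finset.mem_sdiff.1 hi
          rw [if_neg hiA, zero_sub, abs_neg, abs_of_nonneg (div_nonneg (hw i hi) hW0.le)]
      _ ≤ I.card * κ / (N * α) := div_le_div₀ hIκ hout hNα hW
  have hS2 : ∑ i ∈ A, |(if i ∈ A then N⁻¹ else 0) - w i / W| ≤ q + (β / α - 1) := by
    calc _ ≤ ∑ i ∈ A, (q + (β / α - 1)) / N := Finset.sum_le_sum fun i hi => by
          rw [if_pos hi]; exact hpt i hi
      _ = _ := by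
          rw [Finset.sum_const, nsmul_eq_mul]
          exact mul_div_cancel₀ _ hN'.ne'
  linarith

/-- If the information set matches often enough, the transformer is close to the generalized
induction head. -/
theorem l1norm_gih_sub_tf_le {d L M D : ℕ} {S : Finset ℕ} (θ : Params) (x : Fin L → Fin d)
    (hML : M < L) (hS : S ∈ lowDeg M D) (ha : 0 ≤ θ.a) {ε : ℝ} (h1 : delta1 M D S θ ≤ ε)
    (h2 : delta2 M S θ ≤ ε) (hN : 0 < (matchSet M S x).card) :
    l1norm (gih M S x - tf M M D θ x) ≤
      2 * (L / (matchSet M S x).card * Real.exp (4 * (θ.a * ε)) * Real.exp (-θ.a)) +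
        (Real.exp (2 * (θ.a * ε)) - 1) := by
  have hsub : matchSet M S x ⊆ Finset.Icc (M + 1) L := Finset.filter_subset _ _
  have key := l1norm_average_sub_weighted_le hsub hN
    (fun j => Real.exp (θ.a * (feat M M D θ x (L + 1) ⬝ᵥ feat M M D θ x j))) (embed x)
    (fun i _ => l1norm_embed_le_one x i) (fun i _ => (Real.exp_pos _).le)
    (Real.exp_pos (θ.a * (1 - 2 * ε))) (β := Real.exp θ.a) (κ := Real.exp (θ.a * (2 * ε)))
    (fun i hi => Real.exp_le_exp.2 (mul_le_mul_of_nonneg_left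
      (by linarith [le_score_of_mem_matchSet θ x hML hS hi]) ha))
    (fun i hi => Real.exp_le_exp.2
      (mul_le_of_le_one_right ha (score_le_one θ x hML (hsub hi))))
    (Real.exp_pos _).le
    (fun i hi hi' => Real.exp_le_exp.2 (mul_le_mul_of_nonneg_left
      (by linarith [score_le_of_notMem_matchSet θ x hML hS hi hi']) ha))
  have hgih : gih M S x =
      ((matchSet M S x).card : ℝ)⁻¹ • ∑ l ∈ matchSet M S x, embed x l := if_pos hN
  rw [hgih, tf]
  refine key.trans ?_
  have hNr : (0 : ℝ) < (matchSet M S x).card := Nat.cast_pos.2 hN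
  have e1 : Real.exp θ.a / Real.exp (θ.a * (1 - 2 * ε)) = Real.exp (2 * (θ.a * ε)) := by
    rw [← Real.exp_sub]; congr 1; ring
  have e2 : Real.exp (θ.a * (2 * ε)) / Real.exp (θ.a * (1 - 2 * ε)) =
      Real.exp (4 * (θ.a * ε)) * Real.exp (-θ.a) := by
    rw [← Real.exp_sub, ← Real.exp_add]; congr 1; ring
  have hc : ((Finset.Icc (M + 1) L).card : ℝ) ≤ L := by
    rw [Nat.card_Icc]; exact_mod_cast (by omega : L + 1 - (M + 1) ≤ L)
  rw [e1, mul_div_mul_comm, e2, mul_assoc (_ / _)]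
  gcongr


/-! ### Frequency of the matches -/

theorem embed_eq_single_extendTok {d L : ℕ} [NeZero d] (x : Fin L → Fin d) {l : ℕ}
    (h : 1 ≤ l ∧ l ≤ L) : embed x l = Pi.single (extendTok x (l - 1)) 1 := by
  rw [embed_eq_single x h, extendTok, dif_pos (by omega)]

open Classical in
-- The pattern is the last `M` tokens of the prompt. The position right after a copy has the same
-- `M` predecessors as `L + 1`, so it matches at every lag in `[M]`; the final `+ 1` passes from
-- 0-based strings to 1-based rows.
theorem card_isBlock_le_card_matchSet {d L M B r : ℕ} [NeZero d] {S : Finset ℕ} (hM : 0 < M)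
    (hS : S ⊆ Finset.Icc 1 M) (x : Fin L → Fin d) (hL : r + B * M + 1 ≤ L) :
    ((Finset.range B).filter fun k => IsBlock
      (extendTok fun j : Fin M => extendTok x (L - M + j)) (r + k * M) M (extendTok x)).card ≤
      (matchSet M S x).card := by
  refine Finset.card_le_card_of_injOn (fun k => r + (k + 1) * M + 1) ?_ ?_
  · intro k hk
    obtain ⟨hkB, hblk⟩ := Finset.mem_filter.1 hk
    have hk' : (k + 1) * M ≤ B * M := Nat.mul_le_mul_right M (Finset.mem_range.1 hkB)
    have hk'' : (k + 1) * M = k * M + M := by ring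
    refine Finset.mem_filter.2 ⟨Finset.mem_Icc.2 ⟨by simp only []; omega, by simp only []; omega⟩,
      fun s hs => ?_⟩
    have hs' := Finset.mem_Icc.1 (hS hs)
    have := hblk (M - s) (by omega)
    change embed x (r + (k + 1) * M + 1 - s) = _
    rw [embed_eq_single_extendTok x (by omega), embed_eq_single_extendTok x (by omega)]
    congr 1
    rw [show r + (k + 1) * M + 1 - s - 1 = r + k * M + (M - s) by omega, this, extendTok,
      dif_pos (by omega)]
    congr 1
    simp only []
    omega
  · intro k _ k' _ h
    simp only [Nat.add_right_cancel_iff, Nat.add_left_cancel_iff] at h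
    exact Nat.succ_injective (Nat.eq_of_mul_eq_mul_right hM h)

/-- With high probability every set of lags has a positive frequency of matches. -/
theorem le_seqPr_card_matchSet {d n : ℕ} [NeZero d] (pa : Parents n) {π : TransKernel d n}
    {ν : (Fin pa.order → Fin d) → ℝ} (hν : ν ∈ stdSimplex ℝ (Fin pa.order → Fin d)) {γ : ℝ}
    (hγ : 0 < γ) (hγ1 : γ ≤ 1) (hπ : ∀ p x, γ ≤ (π p).1 x) {M L : ℕ} (hM : pa.order < M)
    (hL : 4 * M ≤ L) :
    1 - (d : ℝ) ^ M * (8 * M / γ ^ M) / L ≤ seqPr pa π ν L fun x =>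
      ∀ S ⊆ Finset.Icc 1 M, γ ^ M / (8 * M) * L ≤ ((matchSet M S x).card : ℝ) := by
  have hM0 : 0 < M := (Nat.zero_le _).trans_lt hM
  -- The `- 1` leaves room for the position following the last block.
  set B := (L - 1 - pa.order) / M
  have hB : M * B + (L - 1 - pa.order) % M = L - 1 - pa.order := Nat.div_add_mod _ _
  have hmod : (L - 1 - pa.order) % M < M := Nat.mod_lt _ hM0
  have hBL : L ≤ 2 * (M * B) := by omega
  have hBM : pa.order + B * M + 1 ≤ L := by rw [mul_comm B]; omega
  have hM' : (0 : ℝ) < M := Nat.cast_pos.2 hM0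
  have hL' : (0 : ℝ) < L := Nat.cast_pos.2 (by omega)
  have hη : 0 < γ ^ M := pow_pos hγ M
  have hBL' : (L : ℝ) ≤ 2 * (M * B) := by exact_mod_cast hBL
  have hlow : γ ^ M / (8 * M) * L ≤ γ ^ M * B / 4 := by
    rw [div_mul_eq_mul_div, div_le_iff₀ (by positivity)]
    nlinarith
  have hpos : 0 < γ ^ M / (8 * M) * L := by positivity
  have hexp : Real.exp (-(γ ^ M * B / 4)) ≤ 8 * M / γ ^ M / L := by
    calc Real.exp (-(γ ^ M * B / 4)) ≤ Real.exp (-(γ ^ M / (8 * M) * L)) :=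
          Real.exp_le_exp.2 (neg_le_neg hlow)
      _ ≤ (γ ^ M / (8 * M) * L)⁻¹ := by
          rw [Real.exp_neg]
          exact inv_anti₀ hpos (by linarith [Real.add_one_le_exp (γ ^ M / (8 * M) * L)])
      _ = _ := by field_simp
  calc 1 - (d : ℝ) ^ M * (8 * M / γ ^ M) / L
      ≤ 1 - (d : ℝ) ^ M * Real.exp (-(γ ^ M * B / 4)) := by
        rw [mul_div_assoc]; gcongr
    _ ≤ _ := le_seqPr_forall_block pa hν hγ.le hγ1 hπ (m := M) (B := B) (by omega)
    _ ≤ _ := seqPr_mono hν.1 fun x hx S hS => hlow.trans ((hx _).le.trans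
        (Nat.cast_le.2 (card_isBlock_le_card_matchSet hM0 hS x hBM)))

/-! ### Rates in the prompt length -/

theorem exp_sub_one_le (u : ℝ) : Real.exp u - 1 ≤ u * Real.exp u := by
  have h := mul_le_mul_of_nonneg_right (Real.add_one_le_exp (-u)) (Real.exp_pos u).le
  rw [← Real.exp_add, neg_add_cancel, Real.exp_zero] at h
  linarith

/-- The approximation error when the matches have frequency at least `f` and
`a ≤ c log L`, `Δ₁, Δ₂ ≤ K / L`. -/
theorem l1norm_gih_sub_tf_le_log {d L M D : ℕ} {S : Finset ℕ} (θ : Params) (x : Fin L → Fin d)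
    (hML : M < L) (hS : S ∈ lowDeg M D) {K c f : ℝ} (hK : 0 ≤ K) (hc : 0 ≤ c) (hf : 0 < f)
    (ha : 0 ≤ θ.a) (ha' : θ.a ≤ c * Real.log L) (h1 : delta1 M D S θ ≤ K / L)
    (h2 : delta2 M S θ ≤ K / L) (hN : f * L ≤ ((matchSet M S x).card : ℝ)) :
    l1norm (gih M S x - tf M M D θ x) ≤
      2 * f⁻¹ * Real.exp (4 * (c * K)) * Real.exp (-θ.a) +
        2 * (c * K) * Real.exp (2 * (c * K)) * (Real.log L / L) := by
  have hL : (0 : ℝ) < L := Nat.cast_pos.2 (by omega)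
  have hNpos : (0 : ℝ) < (matchSet M S x).card := (mul_pos hf hL).trans_le hN
  have hlog : Real.log L / L ≤ 1 := by
    rw [div_le_one hL]
    linarith [Real.log_le_sub_one_of_pos hL]
  have hu : θ.a * (K / L) ≤ c * K * (Real.log L / L) := by
    calc θ.a * (K / L) ≤ c * Real.log L * (K / L) :=
          mul_le_mul_of_nonneg_right ha' (by positivity)
      _ = _ := by ring
  have hu' : θ.a * (K / L) ≤ c * K := hu.trans (mul_le_of_le_one_right (by positivity) hlog)
  have hu0 : 0 ≤ θ.a * (K / L) := by positivity
  have hLN : (L : ℝ) / (matchSet M S x).card ≤ f⁻¹ := by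
    rw [div_le_iff₀ hNpos, inv_mul_eq_div, le_div_iff₀ hf]
    linarith
  refine (l1norm_gih_sub_tf_le θ x hML hS ha h1 h2 (Nat.cast_pos.1 hNpos)).trans ?_
  refine add_le_add ?_ ((exp_sub_one_le _).trans ?_)
  · rw [mul_assoc 2 f⁻¹, mul_assoc 2]
    gcongr
  · calc 2 * (θ.a * (K / L)) * Real.exp (2 * (θ.a * (K / L)))
        ≤ 2 * (c * K * (Real.log L / L)) * Real.exp (2 * (c * K)) := by gcongr
      _ = _ := by ring

/-- For `c < 1` the logarithm is absorbed by `y ^ (1 - c)`, leaving `y ^ (-c) ≤ exp (-a)`. -/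
theorem log_div_le_mul_exp_neg {y c a : ℝ} (hy : 0 < y) (hc : c < 1) (ha : a ≤ c * Real.log y) :
    Real.log y / y ≤ (1 - c)⁻¹ * Real.exp (-a) := by
  have h1 : Real.log y ≤ y ^ (1 - c) / (1 - c) := Real.log_le_rpow_div hy.le (sub_pos.2 hc)
  have h2 : y ^ (1 - c) = y * Real.exp (-(c * Real.log y)) := by
    rw [Real.rpow_sub hy, Real.rpow_one, Real.rpow_def_of_pos hy, div_eq_mul_inv, ← Real.exp_neg,
      mul_comm c]
  have h3 : 0 < (1 - c)⁻¹ := inv_pos.2 (sub_pos.2 hc)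
  rw [div_le_iff₀ hy]
  calc Real.log y ≤ y ^ (1 - c) / (1 - c) := h1
    _ = (1 - c)⁻¹ * Real.exp (-(c * Real.log y)) * y := by rw [h2]; ring
    _ ≤ _ := by gcongr

theorem delta1_congr {H D : ℕ} {S : Finset ℕ} {θ θ' : Params} (h : θ.c = θ'.c) :
    delta1 H D S θ = delta1 H D S θ' := by
  simp only [delta1, pRatio, h]

theorem delta2_congr {M : ℕ} {S : Finset ℕ} {θ θ' : Params} (h : θ.w = θ'.w) :
    delta2 M S θ = delta2 M S θ' := by
  simp only [delta2, attnProb, h]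

end NGram
end

theorem mainTheorem2 {d n : ℕ} (pa : NGram.Parents n) (M D : ℕ) (hM : pa.order < M)
    (lam γ : ℝ) (hlam : lam < 1) (hγ : 0 < γ)
    (K c₁ c₂ : ℝ) (hc₁ : 0 < c₁) :
    ∃ C : ℝ, ∀ (Pm : MeasureTheory.Measure (NGram.TransKernel d n)),
      MeasureTheory.IsProbabilityMeasure Pm → NGram.MarkovAssumption pa Pm lam γ →
      ∀ μ₀ ∈ stdSimplex ℝ (Fin pa.order → Fin d),
      ∀ S : Finset ℕ, NGram.IsInfoSet pa M D Pm S →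
      ∀ (L : ℕ), M < L →
      ∀ (Θ : ℝ → NGram.Params) (t₁ t₂ t₃ : ℝ), NGram.IsThreeStage Θ t₁ t₂ t₃ →
        NGram.delta1 M D S (Θ t₁) ≤ K / L →
        NGram.delta2 M S (Θ t₂) ≤ K / L →
        c₁ * Real.log L ≤ (Θ t₃).a → (Θ t₃).a ≤ c₂ * Real.log L →
      ∀ π ∈ Pm.support,
        1 - C / L ≤ NGram.seqPr pa π μ₀ L (fun x =>
          NGram.l1norm (NGram.gih M S x - NGram.tf M M D (Θ t₃) x) ≤
            C * ((L : ℝ) ^ (-((Θ t₃).a / Real.log L)) + Real.log L / L)) ∧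
        (c₂ < 1 →
          1 - C / L ≤ NGram.seqPr pa π μ₀ L (fun x =>
            NGram.l1norm (NGram.gih M S x - NGram.tf M M D (Θ t₃) x) ≤
              C * (L : ℝ) ^ (-((Θ t₃).a / Real.log L)))) := by
  set K' := max K 0
  set c' := max c₂ 0
  set γ' := min γ 1
  have hK' : 0 ≤ K' := le_max_right _ _
  have hc' : 0 ≤ c' := le_max_right _ _
  have hγ' : 0 < γ' := lt_min hγ one_pos
  have hM0 : 0 < M := (Nat.zero_le _).trans_lt hM
  have hM' : (0 : ℝ) < M := Nat.cast_pos.2 hM0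
  set f := γ' ^ M / (8 * M)
  have hf : 0 < f := by positivity
  set C₁ := 2 * f⁻¹ * Real.exp (4 * (c' * K'))
  set C₂ := 2 * (c' * K') * Real.exp (2 * (c' * K'))
  set C₃ := (d : ℝ) ^ M * (8 * M / γ' ^ M)
  -- The absolute value keeps the constant nonnegative before `c₂ < 1` is assumed.
  set C₄ := C₂ * |(1 - c₂)⁻¹|
  have hC₁ : 0 ≤ C₁ := by positivity
  have hC₂ : 0 ≤ C₂ := by positivity
  have hC₃ : 0 ≤ C₃ := by positivity
  have hC₄ : 0 ≤ C₄ := by positivity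
  -- The summand `4 * M` makes the probability bound trivial when `L < 4 * M`.
  refine ⟨C₁ + C₂ + C₃ + C₄ + 4 * M, ?_⟩
  set C := C₁ + C₂ + C₃ + C₄ + 4 * M
  intro Pm _ hPm μ₀ hμ₀ S hS L hML Θ t₁ t₂ t₃ hΘ h1 h2 ha ha' π hπ
  have hL1 : (1 : ℝ) < L := Nat.one_lt_cast.2 (by omega)
  have hL0 : (0 : ℝ) < L := one_pos.trans hL1
  have hlog : 0 < Real.log L := Real.log_pos hL1
  have ha0 : 0 ≤ (Θ t₃).a := (mul_pos hc₁ hlog).le.trans ha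
  -- A probability vector on initial states forces a nonempty vocabulary.
  have hd : NeZero d := by
    obtain ⟨z, -⟩ := Finset.exists_ne_zero_of_sum_ne_zero (hμ₀.2.trans_ne one_ne_zero)
    exact ⟨(Fin.pos (z ⟨0, pa.order_pos⟩)).ne'⟩
  have hrpow : (L : ℝ) ^ (-((Θ t₃).a / Real.log L)) = Real.exp (-(Θ t₃).a) := by
    rw [Real.rpow_def_of_pos hL0, mul_neg, mul_div_cancel₀ _ hlog.ne']
  rw [hrpow]
  -- The `c_S` are frozen after `t₁` and the `w^{(h)}` after `t₂`, so both deficits can be read off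
  -- at `t₃`.
  have s2 := hΘ.stage2 t₂ ⟨hΘ.t₁_le, le_rfl⟩
  have s3 := hΘ.stage3 t₃ ⟨hΘ.t₂_le, le_rfl⟩
  have hKK : K / L ≤ K' / L := by gcongr; exact le_max_left _ _
  have h1' : NGram.delta1 M D S (Θ t₃) ≤ K' / L := by
    rw [NGram.delta1_congr (s3.1.trans s2.1)]; exact h1.trans hKK
  have h2' : NGram.delta2 M S (Θ t₃) ≤ K' / L := by
    rw [NGram.delta2_congr s3.2]; exact h2.trans hKK
  have ha'' : (Θ t₃).a ≤ c' * Real.log L :=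
    ha'.trans (mul_le_mul_of_nonneg_right (le_max_left _ _) hlog.le)
  have hlogL : 0 ≤ Real.log L / L := by positivity
  have hexp := Real.exp_pos (-(Θ t₃).a)
  have main (R : ℝ) (hR : C₁ * Real.exp (-(Θ t₃).a) + C₂ * (Real.log L / L) ≤ R) :
      1 - C / L ≤ NGram.seqPr pa π μ₀ L (fun x =>
          NGram.l1norm (NGram.gih M S x - NGram.tf M M D (Θ t₃) x) ≤ R) := by
    rcases lt_or_ge L (4 * M) with hsmall | hlarge
    · refine le_trans ?_ (NGram.seqPr_nonneg hμ₀.1 _)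
      rw [sub_nonpos, le_div_iff₀ hL0, one_mul]
      have : (L : ℝ) ≤ 4 * M := by exact_mod_cast hsmall.le
      linarith
    · calc 1 - C / L ≤ 1 - C₃ / L := by gcongr; linarith
        _ ≤ _ := NGram.le_seqPr_card_matchSet pa hμ₀ hγ' (min_le_right _ _)
          (fun p x => (min_le_left _ _).trans ((hPm π hπ).2.2 p x)) hM hlarge
        _ ≤ _ := NGram.seqPr_mono hμ₀.1 fun x hx =>
          (NGram.l1norm_gih_sub_tf_le_log (Θ t₃) x hML hS.1 hK' hc' hf ha0 ha'' h1' h2'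
            (hx S (NGram.subset_of_mem_lowDeg hS.1))).trans hR
  refine ⟨main _ ?_, fun hc₂ => main _ ?_⟩
  · rw [mul_add]
    gcongr <;> linarith
  · have h3 : Real.log L / L ≤ |(1 - c₂)⁻¹| * Real.exp (-(Θ t₃).a) :=
      (NGram.log_div_le_mul_exp_neg hL0 hc₂ ha').trans (by gcongr; exact le_abs_self _)
    calc _ ≤ C₁ * Real.exp (-(Θ t₃).a) + C₂ * (|(1 - c₂)⁻¹| * Real.exp (-(Θ t₃).a)) := by gcongr
      _ = (C₁ + C₄) * Real.exp (-(Θ t₃).a) := by simp only [C₄]; ring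
      _ ≤ _ := by gcongr; linarith
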